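/- Let $K$ be a totally real number field with ring of integers $O_K$ whose discriminant is a squarefree integer. Let $\mathrm{Aut}(O_K,\mathrm{tr}_{K/\mathbb{Q}})$ be the group, under composition, of all $\mathbb{Z}$-module automorphisms $\phi$ of $O_K$ such that $\mathrm{Tr}_{K/\mathbb{Q}}(\phi(x)\phi(y))=\mathrm{Tr}_{K/\mathbb{Q}}(xy)$ for all $x,y\in O_K$. Then $$\mathrm{Aut}(O_K,\mathrm{tr}_{K/\mathbb{Q}})=\pm\mathrm{Aut}(K),$$ that is, these automorphisms are exactly the maps $x\mapsto\sigma(x)$ and $x\mapsto-\sigma(x)$ on $O_K$ with $\sigma$ a field automorphism of $K$. Moreover, as a group, $$\mathrm{Aut}(O_K,\mathrm{tr}_{K/\mathbb{Q}})\cong\begin{cases}\mathbb{Z}/2\mathbb{Z}\times\mathbb{Z}/2\mathbb{Z} & \text{if } [K:\mathbb{Q}]=2,\\ \mathbb{Z}/2\mathbb{Z} & \text{otherwise.}\end{cases}$$ -/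

import Mathlib

open scoped NumberField

/-- The automorphism group of the lattice `(M, B)`, where `B` is a bilinear form on the
`R`-module `M`: the `R`-linear automorphisms of `M` which preserve `B`, under composition. -/
def bilinAut {R M : Type*} [CommRing R] [AddCommGroup M] [Module R M]
    (B : LinearMap.BilinForm R M) : Subgroup (M ≃ₗ[R] M) where
  carrier := {φ | ∀ x y : M, B (φ x) (φ y) = B x y}
  mul_mem' := fun {φ ψ} hφ hψ x y => (hφ (ψ x) (ψ y)).trans (hψ x y)
  one_mem' := fun _ _ => rfl
  inv_mem' := fun {φ} hφ x y => by
    have h := hφ (φ.symm x) (φ.symm y)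
    simp only [LinearEquiv.apply_symm_apply] at h
    exact h.symm

/-- The integral trace pairing `(x, y) ↦ Tr_{K/ℚ}(x * y)` on the ring of integers of `K`, with
values in `ℤ`; see `integralTraceForm_apply`. -/
noncomputable def integralTraceForm (K : Type*) [Field K] [NumberField K] :
    LinearMap.BilinForm ℤ (𝓞 K) :=
  Algebra.traceForm ℤ (𝓞 K)

theorem integralTraceForm_apply (K : Type*) [Field K] [NumberField K] (x y : 𝓞 K) :
    (integralTraceForm K x y : ℚ) = Algebra.trace ℚ K ((x : K) * (y : K)) := by
  rw [integralTraceForm, Algebra.traceForm_apply, Algebra.coe_trace_int]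
  simp

/-- The set `± Aut(K)` of maps `𝓞 K → 𝓞 K` of the form `x ↦ σ x` or `x ↦ - σ x`, where `σ` is a
field automorphism of `K` (automatically fixing `ℚ`). -/
def plusMinusAut (K : Type*) [Field K] [NumberField K] : Set (𝓞 K ≃ₗ[ℤ] 𝓞 K) :=
  {φ | ∃ σ : K ≃ₐ[ℚ] K,
    (∀ x : 𝓞 K, ((φ x : 𝓞 K) : K) = σ (x : K)) ∨ (∀ x : 𝓞 K, ((φ x : 𝓞 K) : K) = -σ (x : K))}

/-!
Let `φ` preserve the trace form, and let `A` be the matrix of its `ℚ`-linear extension in the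
coordinates `x ↦ (σ x)_σ` given by the embeddings of `K` into an algebraic closure of `ℚ`. These
coordinates turn the trace form into the standard dot product, so `A` is orthogonal. Since the
discriminant is squarefree, the discriminant group `(𝓞 K)^∨ / 𝓞 K` is cyclic and `φ` acts on it as
an integer `c`; hence `A` differs from `c • 1` by a matrix of algebraic integers. As `K` is totally
real, `A` and all its conjugates are real orthogonal, so by Kronecker's theorem the entries of `A`
are `0`, `1` or `-1`: every row is plus or minus a unit vector, which says that `± φ` is the
restriction of a field automorphism.

A subfield `F ≠ ℚ` with `[K : F] > 1` would contribute the square of its discriminant to that of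
`K`, so there is none. If `K` has a nontrivial automorphism, then the fixed field of all
automorphisms is `ℚ`, the square root of the discriminant lies in `K` and generates a quadratic
field, and so `K` is that field.
-/

section DiscriminantGroup

open Module

theorem exists_int_forall_map_eq_zsmul {A : Type*} [AddCommGroup A]
    (hA : Squarefree (Nat.card A)) (f : A →+ A) : ∃ c : ℤ, ∀ x, f x = c • x := by
  have : Finite A := Nat.finite_of_card_ne_zero hA.ne_zero
  have : IsZGroup (Multiplicative A) := .of_squarefree hA
  exact f.toMultiplicative.map_cyclic

variable {M ι : Type*} [AddCommGroup M] [Fintype ι] [DecidableEq ι]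

theorem natCard_dual_quotient_range (b : Basis ι ℤ M) {B : LinearMap.BilinForm ℤ M}
    (hB : B.Nondegenerate) :
    Nat.card (Dual ℤ M ⧸ LinearMap.range B) = (LinearMap.BilinForm.toMatrix b B).det.natAbs := by
  have : Free ℤ M := .of_basis b
  have : Module.Finite ℤ M := .of_basis b
  let e := LinearEquiv.ofInjective B (LinearMap.ker_eq_bot.mp hB.ker_eq_bot)
  have hmatrix : b.dualBasis.toMatrix ((↑) ∘ b.map e) =
      (LinearMap.BilinForm.toMatrix b B).transpose := by
    ext i j
    simp [Basis.toMatrix_apply, e]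
  rw [← Submodule.natAbs_det_basis_change b.dualBasis _ (b.map e), Basis.det_apply, hmatrix,
    Matrix.det_transpose]

theorem exists_int_forall_comp_symm_eq_zsmul_add (b : Basis ι ℤ M) {B : LinearMap.BilinForm ℤ M}
    (hB : Squarefree (LinearMap.BilinForm.toMatrix b B).det) {φ : M ≃ₗ[ℤ] M}
    (hφ : φ ∈ bilinAut B) :
    ∃ c : ℤ, ∀ f : Dual ℤ M, ∃ y : M, f ∘ₗ φ.symm = c • f + B y := by
  have hcard : Squarefree (Nat.card (Dual ℤ M ⧸ LinearMap.range B)) := by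
    rw [natCard_dual_quotient_range b
      (LinearMap.BilinForm.nondegenerate_of_det_ne_zero B b hB.ne_zero)]
    exact Int.squarefree_natAbs.mpr hB
  have hrange : LinearMap.range B ≤ (LinearMap.range B).comap φ.symm.toLinearMap.dualMap := by
    rintro _ ⟨x, rfl⟩
    exact ⟨φ x, LinearMap.ext fun z => by simpa using hφ x (φ.symm z)⟩
  obtain ⟨c, hc⟩ := exists_int_forall_map_eq_zsmul hcard
    ((LinearMap.range B).mapQ _ _ hrange).toAddMonoidHom
  refine ⟨c, fun f => ?_⟩
  obtain ⟨y, hy⟩ := (Submodule.Quotient.eq _).mp (hc (Submodule.Quotient.mk f))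
  exact ⟨y, by rw [hy, add_sub_cancel]; rfl⟩

end DiscriminantGroup

section ConjugateMatrix

open Module Matrix

variable {F K Ω Ω' ι : Type*} [Field F] [Field K] [Field Ω] [Field Ω'] [Algebra F K] [Algebra F Ω]
  [Algebra F Ω'] [FiniteDimensional F K] [Algebra.IsSeparable F K] [DecidableEq ι]

theorem traceDual_map [Finite ι] (b : Basis ι F K) {Φ : K ≃ₗ[F] K}
    (hΦ : Φ ∈ bilinAut (Algebra.traceForm F K)) (k : ι) :
    (b.map Φ).traceDual k = Φ (b.traceDual k) := by
  have h : ⇑(b.map Φ).traceDual = fun k => Φ (b.traceDual k) :=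
    (b.map Φ).traceDual_eq_iff.mpr fun i j => by
      rw [Basis.map_apply, hΦ, Algebra.traceForm_apply, b.trace_traceDual_mul]
  exact congrFun h k

variable [Fintype ι]

/-- The matrix of the endomorphism `Φ` of `K` in the coordinates `x ↦ (σ x)_σ` on `K`, with `σ`
running over the `F`-embeddings of `K` into `Ω`; see `conjugateMatrix_mulVec`. It does not depend
on the basis `b`, through which the entries are computed. -/
noncomputable def conjugateMatrix (b : Basis ι F K) (Φ : K →ₗ[F] K) :
    Matrix (K →ₐ[F] Ω) (K →ₐ[F] Ω) Ω :=
  of fun σ τ => ∑ k, σ (Φ (b.traceDual k)) * τ (b k)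

theorem conjugateMatrix_apply (b : Basis ι F K) (Φ : K →ₗ[F] K) (σ τ : K →ₐ[F] Ω) :
    conjugateMatrix b Φ σ τ = ∑ k, σ (Φ (b.traceDual k)) * τ (b k) :=
  rfl

theorem map_conjugateMatrix (b : Basis ι F K) (Φ : K →ₗ[F] K) (f : Ω →ₐ[F] Ω')
    (σ τ : K →ₐ[F] Ω) :
    f (conjugateMatrix b Φ σ τ) = conjugateMatrix b Φ (f.comp σ) (f.comp τ) := by
  simp [conjugateMatrix_apply]

variable [IsAlgClosed Ω]

theorem conjugateMatrix_mulVec (b : Basis ι F K) (Φ : K →ₗ[F] K) (x : K) :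
    conjugateMatrix b Φ *ᵥ (fun τ : K →ₐ[F] Ω => τ x) = fun σ => σ (Φ x) := by
  ext σ
  have hx : x = ∑ k, Algebra.trace F K (b k * x) • b.traceDual k := by
    conv_lhs => rw [← b.traceDual.sum_repr x]
    simp_rw [b.traceDual_repr_apply, Algebra.traceForm_apply, mul_comm]
  calc ∑ τ : K →ₐ[F] Ω, conjugateMatrix b Φ σ τ * τ x
      = ∑ k, (∑ τ : K →ₐ[F] Ω, τ (b k * x)) * σ (Φ (b.traceDual k)) := by
        simp_rw [conjugateMatrix_apply, Finset.sum_mul]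
        rw [Finset.sum_comm]
        exact Fintype.sum_congr _ _ fun k => Fintype.sum_congr _ _ fun τ => by rw [map_mul]; ring
    _ = ∑ k, σ (Φ (Algebra.trace F K (b k * x) • b.traceDual k)) := by
        simp_rw [← trace_eq_sum_embeddings Ω, map_smul, ← Algebra.smul_def]
    _ = σ (Φ x) := by rw [← map_sum, ← map_sum, ← hx]

theorem conjugateMatrix_id [DecidableEq (K →ₐ[F] Ω)] (b : Basis ι F K) :
    conjugateMatrix b LinearMap.id = (1 : Matrix (K →ₐ[F] Ω) (K →ₐ[F] Ω) Ω) := by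
  let P : Matrix (K →ₐ[F] Ω) ι Ω := of fun σ k => σ (b.traceDual k)
  let Q : Matrix ι (K →ₐ[F] Ω) Ω := of fun k τ => τ (b k)
  have hQP : Q * P = 1 := by
    ext k l
    have h := trace_eq_sum_embeddings (K := F) Ω (x := b k * b.traceDual l)
    rw [b.trace_mul_traceDual] at h
    simp only [map_mul] at h
    simp [mul_apply, P, Q, ← h, one_apply]
  have hcard : Fintype.card ι = Fintype.card (K →ₐ[F] Ω) := by
    rw [AlgHom.card F K Ω, finrank_eq_card_basis b]
  exact (mul_eq_one_comm_of_card_eq _ _ _ hcard).mp hQP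

theorem conjugateMatrix_mul_transpose [DecidableEq (K →ₐ[F] Ω)] (b : Basis ι F K)
    {Φ : K ≃ₗ[F] K} (hΦ : Φ ∈ bilinAut (Algebra.traceForm F K)) :
    conjugateMatrix b Φ * (conjugateMatrix b Φ)ᵀ = (1 : Matrix (K →ₐ[F] Ω) (K →ₐ[F] Ω) Ω) := by
  ext σ τ
  have hrow (k : ι) : ∑ ρ, conjugateMatrix b Φ σ ρ * ρ (b k) = σ (Φ (b k)) :=
    congrFun (conjugateMatrix_mulVec b Φ (b k)) σ
  calc ∑ ρ, conjugateMatrix b Φ σ ρ * conjugateMatrix b Φ τ ρ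
      = ∑ k, τ (Φ (b.traceDual k)) * ∑ ρ, conjugateMatrix b Φ σ ρ * ρ (b k) := by
        simp_rw [conjugateMatrix_apply b _ τ, Finset.mul_sum]
        rw [Finset.sum_comm]
        simp_rw [mul_left_comm]
        rfl
    _ = conjugateMatrix (b.map Φ) LinearMap.id τ σ := by
        simp_rw [hrow, conjugateMatrix_apply, LinearMap.id_apply, traceDual_map b hΦ,
          Basis.map_apply]
    _ = (1 : Matrix _ _ Ω) σ τ := by
        rw [conjugateMatrix_id, one_apply, one_apply]
        simp only [eq_comm]

end ConjugateMatrix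

section Kronecker

open IntermediateField

variable {L : Type*} [Field L] [CharZero L] [Algebra.IsAlgebraic ℚ L] {x : L}

theorem exists_pow_eq_one_of_forall_norm_le_one (hx : IsIntegral ℤ x) (hx0 : x ≠ 0)
    (hnorm : ∀ f : L →ₐ[ℚ] ℂ, ‖f x‖ ≤ 1) : ∃ n ≠ 0, x ^ n = 1 := by
  let y := AdjoinSimple.gen ℚ x
  have hy : IsIntegral ℤ y := coe_isIntegral_iff.mp hx
  have hy0 : y ≠ 0 := fun h => hx0 (congrArg Subtype.val h)
  have hnorm_gen (φ : ℚ⟮x⟯ →+* ℂ) : ‖φ y‖ ≤ 1 := by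
    obtain ⟨f, hf⟩ :=
      IsAlgClosed.surjective_domRestrict_of_isAlgebraic (E := L) φ.toRatAlgHom
    have hfx : f x = φ y := DFunLike.congr_fun hf y
    exact hfx ▸ hnorm f
  have : NumberField ℚ⟮x⟯ := {
    to_charZero := ℚ⟮x⟯.charZero
    to_finiteDimensional := adjoin.finiteDimensional (Algebra.IsIntegral.isIntegral x) }
  obtain ⟨n, hn, hyn⟩ :=
    NumberField.Embeddings.pow_eq_one_of_norm_le_one ℚ⟮x⟯ ℂ hy0 hy hnorm_gen
  exact ⟨n, hn.ne', congrArg Subtype.val hyn⟩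

theorem eq_zero_or_one_or_neg_one_of_isIntegral (hx : IsIntegral ℤ x)
    (hnorm : ∀ f : L →ₐ[ℚ] ℂ, ‖f x‖ ≤ 1) (f : L →ₐ[ℚ] ℂ) {r : ℝ} (hr : f x = r) :
    x = 0 ∨ x = 1 ∨ x = -1 := by
  refine or_iff_not_imp_left.mpr fun hx0 => ?_
  obtain ⟨n, hn, hxn⟩ := exists_pow_eq_one_of_forall_norm_le_one hx hx0 hnorm
  have hrn : r ^ n = 1 := by
    have h : f x ^ n = 1 := by rw [← map_pow, hxn, map_one]
    rw [hr] at h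
    exact_mod_cast h
  have hr1 : |r| = 1 := (abs_pow_eq_one r hn).mp (by rw [hrn, abs_one])
  have hsq : r ^ 2 = 1 := by rw [← sq_abs, hr1, one_pow]
  refine sq_eq_one_iff.mp (FaithfulSMul.algebraMap_injective L L (f.injective ?_))
  change f (x ^ 2) = f 1
  rw [map_pow, hr, map_one]
  exact_mod_cast hsq

end Kronecker

theorem exists_eq_single_units {R ι : Type*} [CommRing R] [CharZero R] [Fintype ι] [DecidableEq ι]
    {v : ι → R} (hv : ∀ i, v i = 0 ∨ v i = 1 ∨ v i = -1) (hsum : ∑ i, v i ^ 2 = 1) :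
    ∃ (i : ι) (ε : ℤˣ), v = Pi.single i ((ε : ℤ) : R) := by
  classical
  have hsq (i : ι) : v i ^ 2 = if v i ≠ 0 then 1 else 0 := by
    rcases hv i with h | h | h <;> simp [h]
  have hcard : Finset.card {i | v i ≠ 0} = 1 := by
    simp_rw [hsq, Finset.sum_boole] at hsum
    exact_mod_cast hsum
  obtain ⟨i, hi⟩ := Finset.card_eq_one.mp hcard
  have hsupp (j : ι) : v j ≠ 0 ↔ j = i := by
    simpa using Finset.ext_iff.mp hi j
  obtain ⟨ε, hε⟩ : ∃ ε : ℤˣ, v i = ((ε : ℤ) : R) := by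
    rcases (hv i).resolve_left ((hsupp i).mpr rfl) with h | h
    · exact ⟨1, by simp [h]⟩
    · exact ⟨-1, by simp [h]⟩
  refine ⟨i, ε, funext fun j => ?_⟩
  obtain rfl | hj := eq_or_ne j i
  · rw [hε, Pi.single_eq_same]
  · rw [Pi.single_eq_of_ne hj, ← not_ne_iff, hsupp]
    exact hj

section Extension

open NumberField nonZeroDivisors

variable {K : Type*} [Field K] [NumberField K]

/-- The `ℚ`-linear extension to `K` of an additive automorphism of the ring of integers, obtained
by viewing `K` as the localization of `𝓞 K` at the nonzero integers. -/
noncomputable def rationalExtension (φ : 𝓞 K ≃ₗ[ℤ] 𝓞 K) : K ≃ₗ[ℚ] K :=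
  IsLocalizedModule.mapEquiv ℤ⁰ (IsScalarTower.toAlgHom ℤ (𝓞 K) K).toLinearMap
    (IsScalarTower.toAlgHom ℤ (𝓞 K) K).toLinearMap ℚ φ

theorem rationalExtension_coe (φ : 𝓞 K ≃ₗ[ℤ] 𝓞 K) (x : 𝓞 K) :
    rationalExtension φ x = φ x :=
  IsLocalizedModule.map_apply _ _ _ _ x

theorem rationalExtension_mem_bilinAut {φ : 𝓞 K ≃ₗ[ℤ] 𝓞 K}
    (hφ : φ ∈ bilinAut (integralTraceForm K)) :
    rationalExtension φ ∈ bilinAut (Algebra.traceForm ℚ K) := by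
  suffices h : (Algebra.traceForm ℚ K).comp (rationalExtension φ).toLinearMap
      (rationalExtension φ).toLinearMap = Algebra.traceForm ℚ K from
    fun x y => LinearMap.congr_fun₂ h x y
  refine LinearMap.BilinForm.ext_basis (integralBasis K) fun i j => ?_
  simp only [LinearMap.BilinForm.comp_apply, integralBasis_apply, LinearEquiv.coe_coe,
    rationalExtension_coe, Algebra.traceForm_apply]
  rw [← integralTraceForm_apply, ← integralTraceForm_apply, hφ]

theorem trace_traceDual_integralBasis_mul (k : Module.Free.ChooseBasisIndex ℤ (𝓞 K)) (x : 𝓞 K) :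
    Algebra.trace ℚ K ((integralBasis K).traceDual k * x) = (RingOfIntegers.basis K).coord k x := by
  have h := (integralBasis K).traceDual.traceDual_repr_apply (x : K) k
  rw [Module.Basis.traceDual_traceDual, Algebra.traceForm_apply, integralBasis_repr_apply] at h
  rw [mul_comm, ← h]
  rfl

end Extension

section TotallyReal

open Module Matrix NumberField

variable {K ι : Type*} [Field K] [NumberField K] [IsTotallyReal K] [Fintype ι] [DecidableEq ι]

theorem conj_conjugateMatrix (b : Basis ι ℚ K) (Φ : K →ₗ[ℚ] K) (σ τ : K →ₐ[ℚ] ℂ) :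
    starRingEnd ℂ (conjugateMatrix b Φ σ τ) = conjugateMatrix b Φ σ τ := by
  have hreal (ρ : K →ₐ[ℚ] ℂ) (x : K) : starRingEnd ℂ (ρ x) = ρ x :=
    RingHom.congr_fun (IsTotallyReal.complexEmbedding_isReal (ρ : K →+* ℂ)) x
  simp only [conjugateMatrix_apply, map_sum, map_mul, hreal]

theorem norm_conjugateMatrix_le_one (b : Basis ι ℚ K) {Φ : K ≃ₗ[ℚ] K}
    (hΦ : Φ ∈ bilinAut (Algebra.traceForm ℚ K)) (σ τ : K →ₐ[ℚ] ℂ) :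
    ‖conjugateMatrix b Φ σ τ‖ ≤ 1 := by
  classical
  have hstar : star (conjugateMatrix b (Φ : K →ₗ[ℚ] K)) = (conjugateMatrix b Φ : Matrix _ _ ℂ)ᵀ :=
    Matrix.ext fun σ τ => conj_conjugateMatrix b Φ τ σ
  refine entry_norm_bound_of_unitary (mem_unitaryGroup_iff.mpr ?_) σ τ
  rw [hstar, conjugateMatrix_mul_transpose b hΦ]

variable {Ω : Type*} [Field Ω] [CharZero Ω] [Algebra.IsAlgebraic ℚ Ω]

theorem conjugateMatrix_eq_zero_or_one_or_neg_one (b : Basis ι ℚ K) {Φ : K ≃ₗ[ℚ] K}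
    (hΦ : Φ ∈ bilinAut (Algebra.traceForm ℚ K))
    {σ τ : K →ₐ[ℚ] Ω} (hint : IsIntegral ℤ (conjugateMatrix b Φ σ τ)) :
    conjugateMatrix b Φ σ τ = 0 ∨ conjugateMatrix b Φ σ τ = 1 ∨ conjugateMatrix b Φ σ τ = -1 := by
  let f : Ω →ₐ[ℚ] ℂ := IsAlgClosed.lift
  obtain ⟨r, hr⟩ := Complex.conj_eq_iff_real.mp
    (conj_conjugateMatrix b Φ (f.comp σ) (f.comp τ))
  refine eq_zero_or_one_or_neg_one_of_isIntegral hint (fun f => ?_) f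
    ((map_conjugateMatrix b Φ f σ τ).trans hr)
  rw [map_conjugateMatrix]
  exact norm_conjugateMatrix_le_one b hΦ _ _

theorem exists_forall_apply_eq_units_smul [IsAlgClosed Ω] (b : Basis ι ℚ K) {Φ : K ≃ₗ[ℚ] K}
    (hΦ : Φ ∈ bilinAut (Algebra.traceForm ℚ K)) {σ : K →ₐ[ℚ] Ω}
    (hint : ∀ τ, IsIntegral ℤ (conjugateMatrix b Φ σ τ)) :
    ∃ (τ : K →ₐ[ℚ] Ω) (ε : ℤˣ), ∀ x, σ (Φ x) = ε • τ x := by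
  classical
  have hsum : ∑ τ, conjugateMatrix b Φ σ τ ^ 2 = 1 := by
    have h := congrFun₂ (conjugateMatrix_mul_transpose (Ω := Ω) b hΦ) σ σ
    rw [mul_apply, one_apply_eq] at h
    simpa only [transpose_apply, ← sq] using h
  obtain ⟨τ, ε, hrow⟩ := exists_eq_single_units
    (fun τ => conjugateMatrix_eq_zero_or_one_or_neg_one b hΦ (hint τ)) hsum
  refine ⟨τ, ε, fun x => ?_⟩
  calc σ (Φ x) = conjugateMatrix b Φ σ ⬝ᵥ fun τ => τ x :=
        (congrFun (conjugateMatrix_mulVec b Φ x) σ).symm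
    _ = Pi.single τ ((ε : ℤ) : Ω) ⬝ᵥ fun τ => τ x := congrArg (· ⬝ᵥ _) hrow
    _ = ((ε : ℤ) : Ω) * τ x := single_dotProduct _ _ _
    _ = ε • τ x := by rw [Units.smul_def, zsmul_eq_mul]

end TotallyReal

theorem exists_algEquiv_of_algHom_comp_eq {F K Ω : Type*} [Field F] [Field K] [Field Ω]
    [Algebra F K] [Algebra F Ω] [Algebra.IsAlgebraic F K] {Φ : K →ₗ[F] K} {σ τ : K →ₐ[F] Ω}
    (h : ∀ x, σ (Φ x) = τ x) : ∃ ρ : K ≃ₐ[F] K, ∀ x, Φ x = ρ x := by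
  let f : K →ₐ[F] K := AlgHom.ofLinearMap Φ
    (σ.injective (by simp [h]))
    (fun x y => σ.injective (by simp [h]))
  exact ⟨AlgEquiv.ofBijective f (Algebra.IsAlgebraic.algHom_bijective f), fun _ => rfl⟩

section TraceFormAutomorphisms

open NumberField

variable {K : Type*} [Field K] [NumberField K]

theorem exists_rationalExtension_traceDual_eq (hK : Squarefree (discr K)) {φ : 𝓞 K ≃ₗ[ℤ] 𝓞 K}
    (hφ : φ ∈ bilinAut (integralTraceForm K)) :
    ∃ c : ℤ, ∀ k, ∃ y : 𝓞 K, rationalExtension φ ((integralBasis K).traceDual k) =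
      c • (integralBasis K).traceDual k + y := by
  let b := RingOfIntegers.basis K
  let d := (integralBasis K).traceDual
  have hdet : Squarefree (LinearMap.BilinForm.toMatrix b (integralTraceForm K)).det := by
    have h : LinearMap.BilinForm.toMatrix b (integralTraceForm K) = Algebra.traceMatrix ℤ b :=
      Matrix.ext fun _ _ => LinearMap.BilinForm.toMatrix_apply ..
    rwa [h, ← Algebra.discr_def, discr_eq_discr]
  obtain ⟨c, hc⟩ := exists_int_forall_comp_symm_eq_zsmul_add b hdet hφ
  refine ⟨c, fun k => ?_⟩
  obtain ⟨y, hy⟩ := hc (b.coord k)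
  refine ⟨y, d.ext_elem fun j => ?_⟩
  simp only [d, Module.Basis.traceDual_repr_apply, Algebra.traceForm_apply]
  calc Algebra.trace ℚ K (rationalExtension φ (d k) * integralBasis K j)
      = Algebra.trace ℚ K (rationalExtension φ (d k) * rationalExtension φ (φ.symm (b j))) := by
        rw [rationalExtension_coe, φ.apply_symm_apply, integralBasis_apply]
    _ = Algebra.trace ℚ K (d k * φ.symm (b j)) := rationalExtension_mem_bilinAut hφ _ _
    _ = ((c • b.coord k + integralTraceForm K y) (b j) : ℤ) := by
        rw [trace_traceDual_integralBasis_mul, ← hy]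
        rfl
    _ = c • Algebra.trace ℚ K (d k * b j) + Algebra.trace ℚ K (y * b j) := by
        rw [LinearMap.add_apply, LinearMap.smul_apply, Int.cast_add, smul_eq_mul, Int.cast_mul,
          integralTraceForm_apply, trace_traceDual_integralBasis_mul, zsmul_eq_mul]
    _ = Algebra.trace ℚ K ((c • d k + y) * integralBasis K j) := by
        rw [add_mul, map_add, smul_mul_assoc, map_zsmul, integralBasis_apply]

theorem isIntegral_conjugateMatrix (hK : Squarefree (discr K)) {φ : 𝓞 K ≃ₗ[ℤ] 𝓞 K}
    (hφ : φ ∈ bilinAut (integralTraceForm K)) {Ω : Type*} [Field Ω] [Algebra ℚ Ω] [IsAlgClosed Ω]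
    (σ τ : K →ₐ[ℚ] Ω) :
    IsIntegral ℤ (conjugateMatrix (integralBasis K) (rationalExtension φ) σ τ) := by
  classical
  obtain ⟨c, hc⟩ := exists_rationalExtension_traceDual_eq hK hφ
  choose y hy using hc
  have hmatrix : conjugateMatrix (integralBasis K) (rationalExtension φ) σ τ =
      c • (1 : Matrix _ _ Ω) σ τ + ∑ k, σ (y k) * τ (integralBasis K k) := by
    simp only [← conjugateMatrix_id (integralBasis K), conjugateMatrix_apply, LinearEquiv.coe_coe,
      hy, map_add, map_zsmul, add_mul, Finset.sum_add_distrib, Finset.smul_sum, smul_mul_assoc,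
      LinearMap.id_apply]
  have hint (ρ : K →ₐ[ℚ] Ω) (z : 𝓞 K) : IsIntegral ℤ (ρ z) :=
    z.isIntegral_coe.map (ρ.restrictScalars ℤ)
  have hone : IsIntegral ℤ ((1 : Matrix _ _ Ω) σ τ) := by
    rw [Matrix.one_apply]
    split_ifs
    exacts [isIntegral_one, isIntegral_zero]
  rw [hmatrix]
  refine (hone.smul c).add (IsIntegral.sum _ fun k _ => (hint σ _).mul ?_)
  rw [integralBasis_apply]
  exact hint τ _

theorem exists_forall_eq_units_smul_algEquiv [IsTotallyReal K] (hK : Squarefree (discr K))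
    {φ : 𝓞 K ≃ₗ[ℤ] 𝓞 K} (hφ : φ ∈ bilinAut (integralTraceForm K)) :
    ∃ (ρ : K ≃ₐ[ℚ] K) (ε : ℤˣ), ∀ x : 𝓞 K, (φ x : K) = ε • ρ x := by
  have : Algebra.IsAlgebraic ℚ (AlgebraicClosure K) := .trans ℚ K _
  let σ : K →ₐ[ℚ] AlgebraicClosure K := Algebra.algHom ..
  obtain ⟨τ, ε, hτ⟩ := exists_forall_apply_eq_units_smul (integralBasis K)
    (rationalExtension_mem_bilinAut hφ) (isIntegral_conjugateMatrix hK hφ σ)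
  obtain ⟨ρ, hρ⟩ := exists_algEquiv_of_algHom_comp_eq
    (Φ := (ε : ℤ) • (rationalExtension φ).toLinearMap) (σ := σ) (τ := τ) fun x => by
      rw [LinearMap.smul_apply, map_zsmul, ← Units.smul_def, LinearEquiv.coe_coe, hτ, smul_smul,
        Int.units_mul_self, one_smul]
  refine ⟨ρ, ε, fun x => ?_⟩
  rw [← hρ, LinearMap.smul_apply, ← Units.smul_def, smul_smul, Int.units_mul_self, one_smul,
    LinearEquiv.coe_coe, rationalExtension_coe]

end TraceFormAutomorphisms

section Discriminant

open Module NumberField IntermediateField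

theorem isSquare_algebraMap_discr {F K ι : Type*} [Field F] [Field K] [Algebra F K]
    [FiniteDimensional F K] [IsGalois F K] [Fintype ι] [DecidableEq ι] (b : Basis ι F K) :
    IsSquare (algebraMap F K (Algebra.discr F b)) := by
  obtain ⟨e⟩ : Nonempty (ι ≃ Gal(K/F)) := by
    rw [← Finite.card_eq, IsGalois.card_aut_eq_finrank, finrank_eq_nat_card_basis b]
  let A : Matrix ι ι K := .of fun i j => e j (b i)
  have hA : (algebraMap F K).mapMatrix (Algebra.traceMatrix F b) = A * A.transpose := by
    ext i j
    simp only [RingHom.mapMatrix_apply, Matrix.map_apply, Algebra.traceMatrix_apply,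
      Algebra.traceForm_apply, trace_eq_sum_automorphisms, map_mul]
    exact (e.sum_comp fun σ => σ (b i) * σ (b j)).symm
  refine ⟨A.det, ?_⟩
  rw [Algebra.discr_def, RingHom.map_det, hA, Matrix.det_mul, Matrix.det_transpose]

theorem finrank_adjoin_simple_eq_two {F L : Type*} [Field F] [Field L] [Algebra F L] {a : F}
    (ha : ¬IsSquare a) {x : L} (hx : x ^ 2 = algebraMap F L a) : finrank F F⟮x⟯ = 2 := by
  have hmonic : (Polynomial.X ^ 2 - Polynomial.C a).Monic :=
    Polynomial.monic_X_pow_sub_C a two_ne_zero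
  have hroot : Polynomial.aeval x (Polynomial.X ^ 2 - Polynomial.C a) = 0 := by simp [hx]
  have hirr : Irreducible (Polynomial.X ^ 2 - Polynomial.C a) :=
    X_pow_sub_C_irreducible_of_prime Nat.prime_two fun y hy => ha ⟨y, by rw [← hy, sq]⟩
  rw [adjoin.finrank ⟨_, hmonic, hroot⟩, ← minpoly.eq_of_irreducible_of_monic hirr hroot hmonic,
    Polynomial.natDegree_X_pow_sub_C]

variable {K : Type*} [Field K] [NumberField K]

theorem not_isSquare_discr (hK : Squarefree (discr K)) (hn : 1 < finrank ℚ K) :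
    ¬IsSquare (discr K : ℚ) := by
  rw [Rat.isSquare_intCast_iff]
  rintro ⟨m, hm⟩
  have hdiscr : discr K = 1 := hm.trans (Int.isUnit_mul_self (hK m ⟨1, by rw [hm, mul_one]⟩))
  have := abs_discr_gt_two hn
  norm_num [hdiscr] at this

theorem finrank_eq_one_of_squarefree_discr (hK : Squarefree (discr K)) (F : IntermediateField ℚ K)
    (hF : 1 < finrank F K) : finrank ℚ F = 1 := by
  have hdvd : (discr F).natAbs * (discr F).natAbs ∣ (discr K).natAbs := by
    rw [natAbs_discr_eq_absNorm_differentIdeal_mul_natAbs_discr_pow F (𝓞 F) K (𝓞 K), ← sq]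
    exact (pow_dvd_pow _ hF).mul_left _
  have hdiscr : (discr F).natAbs = 1 :=
    Nat.isUnit_iff.mp (Int.squarefree_natAbs.mpr hK _ hdvd)
  by_contra hne
  have hlt : 1 < finrank ℚ F := Nat.lt_of_le_of_ne finrank_pos (Ne.symm hne)
  have hgt := abs_discr_gt_two hlt
  rw [Int.abs_eq_natAbs, hdiscr] at hgt
  norm_num at hgt

theorem finrank_eq_two_of_algEquiv_ne_one (hK : Squarefree (discr K)) {σ : K ≃ₐ[ℚ] K}
    (hσ : σ ≠ 1) : finrank ℚ K = 2 := by
  have : Nontrivial Gal(K/ℚ) := ⟨σ, 1, hσ⟩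
  have : IsGalois ℚ K := by
    refine IsGalois.of_fixedField_eq_bot ℚ K (finrank_eq_one_iff.mp ?_)
    refine finrank_eq_one_of_squarefree_discr hK _ ?_
    rw [finrank_fixedField_eq_card]
    exact (Subgroup.one_lt_card_iff_ne_bot ⊤).mpr top_ne_bot
  have hn : 1 < finrank ℚ K := by
    rw [← IsGalois.card_aut_eq_finrank]
    exact Finite.one_lt_card
  obtain ⟨δ, hδ⟩ := isSquare_algebraMap_discr (integralBasis K)
  rw [← coe_discr, ← sq] at hδ
  have hδ2 := finrank_adjoin_simple_eq_two (not_isSquare_discr hK hn) hδ.symm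
  have htop : finrank ℚ⟮δ⟯ K = 1 := by
    by_contra hne
    have := finrank_eq_one_of_squarefree_discr hK ℚ⟮δ⟯
      (Nat.lt_of_le_of_ne finrank_pos (Ne.symm hne))
    omega
  rw [← finrank_mul_finrank ℚ ℚ⟮δ⟯ K, hδ2, htop]

end Discriminant

section SignedAut

open NumberField

/-- The automorphism `x ↦ ε • σ x` of the additive group of the ring of integers attached to a
field automorphism `σ` and a sign `ε`. -/
noncomputable def signedAut (K : Type*) [Field K] [NumberField K] :
    (K ≃ₐ[ℚ] K) × ℤˣ →* (𝓞 K ≃ₗ[ℤ] 𝓞 K) where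
  toFun p :=
    (RingOfIntegers.mapRingEquiv p.1).toAddEquiv.toIntLinearEquiv.trans
      (DistribMulAction.toLinearEquiv ℤ (𝓞 K) p.2)
  map_one' := by
    ext x
    simp
  map_mul' p q := by
    ext x
    simp [Units.smul_def, mul_assoc]

variable {K : Type*} [Field K] [NumberField K]

theorem signedAut_apply (p : (K ≃ₐ[ℚ] K) × ℤˣ) (x : 𝓞 K) : (signedAut K p x : K) = p.2 • p.1 x := by
  simp [signedAut, Units.smul_def]

theorem signedAut_mem_bilinAut (p : (K ≃ₐ[ℚ] K) × ℤˣ) :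
    signedAut K p ∈ bilinAut (integralTraceForm K) := by
  intro x y
  rw [← Int.cast_inj (α := ℚ), integralTraceForm_apply, integralTraceForm_apply, signedAut_apply,
    signedAut_apply, smul_mul_smul_comm, Int.units_mul_self, one_smul, ← map_mul,
    Algebra.trace_eq_of_algEquiv]

theorem signedAut_injective : Function.Injective (signedAut K) := by
  refine (injective_iff_map_eq_one _).mpr fun ⟨σ, ε⟩ h => ?_
  have hx (x : 𝓞 K) : ε • σ x = x := by rw [← signedAut_apply (σ, ε), h]; rfl
  have hε : ε = 1 := by
    have h1 := hx 1
    simp only [map_one, Units.smul_def, zsmul_one] at h1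
    exact Units.ext (Int.cast_injective (h1.trans Int.cast_one.symm))
  subst hε
  refine Prod.ext (AlgEquiv.ext fun x => ?_) rfl
  obtain ⟨a, b, -, rfl⟩ := IsFractionRing.div_surjective (A := 𝓞 K) x
  simpa using congrArg₂ (· / ·) (hx a) (hx b)

theorem bilinAut_eq_range_signedAut [IsTotallyReal K] (hK : Squarefree (discr K)) :
    bilinAut (integralTraceForm K) = (signedAut K).range := by
  refine le_antisymm (fun φ hφ => ?_) ?_
  · obtain ⟨ρ, ε, h⟩ := exists_forall_eq_units_smul_algEquiv hK hφ
    refine ⟨(ρ, ε), LinearEquiv.ext fun x => RingOfIntegers.ext ?_⟩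
    rw [h, signedAut_apply]
  · rintro _ ⟨p, rfl⟩
    exact signedAut_mem_bilinAut p

theorem plusMinusAut_eq_range_signedAut : plusMinusAut K = (signedAut K).range := by
  ext φ
  have hφ (p : (K ≃ₐ[ℚ] K) × ℤˣ) : signedAut K p = φ ↔ ∀ x, (φ x : K) = p.2 • p.1 x := by
    simp only [LinearEquiv.ext_iff, RingOfIntegers.ext_iff, signedAut_apply, eq_comm]
  simp only [plusMinusAut, Set.mem_ofPred_eq, SetLike.mem_coe, MonoidHom.mem_range, Prod.exists, hφ]
  refine exists_congr fun σ => ⟨?_, fun ⟨ε, h⟩ => ?_⟩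
  · rintro (h | h)
    · exact ⟨1, by simpa using h⟩
    · exact ⟨-1, by simpa using h⟩
  · rcases Int.units_eq_one_or ε with rfl | rfl
    · exact .inl (by simpa using h)
    · exact .inr (by simpa using h)

theorem nonempty_bilinAut_mulEquiv [IsTotallyReal K] (hK : Squarefree (discr K)) :
    Nonempty (bilinAut (integralTraceForm K) ≃* (K ≃ₐ[ℚ] K) × ℤˣ) :=
  ⟨(MulEquiv.subgroupCongr (bilinAut_eq_range_signedAut hK)).trans
    (MonoidHom.ofInjective signedAut_injective).symm⟩

end SignedAut

theorem theorem4p4 (K : Type*) [Field K] [NumberField K] [NumberField.IsTotallyReal K]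
    (hK : Squarefree (NumberField.discr K)) :
    (bilinAut (integralTraceForm K) : Set (𝓞 K ≃ₗ[ℤ] 𝓞 K)) = plusMinusAut K ∧
    (Module.finrank ℚ K = 2 →
      Nonempty (bilinAut (integralTraceForm K) ≃*
        Multiplicative (ZMod 2) × Multiplicative (ZMod 2))) ∧
    (Module.finrank ℚ K ≠ 2 →
      Nonempty (bilinAut (integralTraceForm K) ≃* Multiplicative (ZMod 2))) := by
  obtain ⟨e⟩ := nonempty_bilinAut_mulEquiv hK
  have : Fact (Nat.Prime 2) := ⟨Nat.prime_two⟩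
  have hcard : Nat.card (Multiplicative (ZMod 2)) = 2 := Nat.card_zmod 2
  have hunits : Nat.card ℤˣ = 2 := by simp
  let eUnits : ℤˣ ≃* Multiplicative (ZMod 2) := mulEquivOfPrimeCardEq hunits hcard
  refine ⟨?_, fun hn => ?_, fun hn => ?_⟩
  · rw [bilinAut_eq_range_signedAut hK, plusMinusAut_eq_range_signedAut]
  · have : Algebra.IsQuadraticExtension ℚ K := ⟨hn⟩
    have hgal : Nat.card Gal(K/ℚ) = 2 := (IsGalois.card_aut_eq_finrank ℚ K).trans hn
    exact ⟨e.trans ((mulEquivOfPrimeCardEq hgal hcard).prodCongr eUnits)⟩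
  · have : Unique Gal(K/ℚ) :=
      ⟨⟨1⟩, fun _ => by_contra fun hσ => hn (finrank_eq_two_of_algEquiv_ne_one hK hσ)⟩
    exact ⟨e.trans (MulEquiv.uniqueProd.trans eUnits)⟩
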